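/- Let $k$ be a field of characteristic $p>0$, let $\boldsymbol t=(t_1,\ldots,t_n)$ be indeterminates, and let $f,g\in k[[\boldsymbol t]]$ be power series that are algebraic over $k(\boldsymbol t)$. For an algebraic power series $f$, consider the nonzero polynomials $A(\boldsymbol t,y)\in k[\boldsymbol t,y]$ with $A(\boldsymbol t,f)=0$: the degree of $f$ is the minimal degree in $y$ of such an $A$ (equivalently, $[k(\boldsymbol t)(f):k(\boldsymbol t)]$); the total height of $f$ is the minimal total degree in $\boldsymbol t$ of such an $A$; and the partial height of $f$ is $(h_1,\ldots,h_n)$, where, for each $i$, $h_i$ is the minimal degree in $t_i$ of such an $A$. Let $f$ and $g$ have degree $d$ and $d'$, total height $h$ and $h'$, and partial height $(h_1,\ldots,h_n)$ and $(h'_1,\ldots,h'_n)$, respectively. Set \[ N_1 := (d+1)\cdot\min\left\{\prod_{i=1}^n(h_i+1),\ \binom{n+h}{n}\right\},\qquad N_2 := (d'+1)\cdot\min\left\{\prod_{i=1}^n(h'_i+1),\ \binom{n+h'}{n}\right\}. \] Then the Hadamard product $f\odot g:=\sum_{\boldsymbol i\in\mathbb N^n}a(\boldsymbol i)b(\boldsymbol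 i)\,\boldsymbol t^{\boldsymbol i}$ of $f=\sum_{\boldsymbol i\in\mathbb N^n}a(\boldsymbol i)\boldsymbol t^{\boldsymbol i}$ and $g=\sum_{\boldsymbol i\in\mathbb N^n}b(\boldsymbol i)\boldsymbol t^{\boldsymbol i}$ is algebraic over $k(\boldsymbol t)$, of degree at most $p^{N_1N_2}-1$. -/

import Mathlib

open Polynomial

namespace AlgSeries

variable {k : Type*} [Field k] {n : ℕ}

/-- The degree in `t_i` of a polynomial `A ∈ k[t_1, …, t_n][y]`. -/
noncomputable def degT (i : Fin n) (A : (MvPolynomial (Fin n) k)[X]) : ℕ :=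
  A.support.sup fun j => (A.coeff j).degreeOf i

/-- The total degree in `t = (t_1, …, t_n)` of a polynomial `A ∈ k[t_1, …, t_n][y]`. -/
noncomputable def totalDegT (A : (MvPolynomial (Fin n) k)[X]) : ℕ :=
  A.support.sup fun j => (A.coeff j).totalDegree

/-- The nonzero polynomials `A ∈ k[t][y]` such that `A(t, f) = 0`. -/
def annihilators (f : MvPowerSeries (Fin n) k) : Set (MvPolynomial (Fin n) k)[X] :=
  {A | A ≠ 0 ∧ aeval f A = 0}

/-- `f` is algebraic of degree `d`: `d` is the minimal degree in `y` of a nonzero polynomial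
annihilating `f`. -/
def HasDegree (f : MvPowerSeries (Fin n) k) (d : ℕ) : Prop :=
  IsLeast (Polynomial.natDegree '' annihilators f) d

/-- `f` has total height `h`: `h` is the minimal total degree in `t` of a nonzero polynomial
annihilating `f`. -/
def HasTotalHeight (f : MvPowerSeries (Fin n) k) (h : ℕ) : Prop :=
  IsLeast (totalDegT '' annihilators f) h

/-- `f` has partial height `(h_1, …, h_n)`: for each `i`, `h_i` is the minimal degree in `t_i` of
a nonzero polynomial annihilating `f` (the polynomial may depend on `i`). -/
def HasPartialHeight (f : MvPowerSeries (Fin n) k) (h : Fin n → ℕ) : Prop :=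
  ∀ i, IsLeast (degT i '' annihilators f) (h i)

/-- The Hadamard (coefficientwise) product of two power series. -/
noncomputable def hadamard (f g : MvPowerSeries (Fin n) k) : MvPowerSeries (Fin n) k :=
  fun m => MvPowerSeries.coeff m f * MvPowerSeries.coeff m g

/-- The number `(d + 1) · min {∏ (h_i + 1), C(n + h, n)}`. -/
def dimBound (n d h : ℕ) (hp : Fin n → ℕ) : ℕ :=
  (d + 1) * min (∏ i, (hp i + 1)) ((n + h).choose n)

end AlgSeries

namespace AlgSeries

section Sections

variable {σ K : Type*} [Field K] (p : ℕ) [Fact p.Prime] [CharP K p]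

theorem coeff_smul_pow_char [Finite σ] (u : MvPowerSeries σ K) (m : σ →₀ ℕ) :
    MvPowerSeries.coeff (p • m) (u ^ p) = MvPowerSeries.coeff m u ^ p := by
  rw [← MvPowerSeries.map_frobenius_expand p (Fact.out : p.Prime).ne_zero, MvPowerSeries.coeff_map,
    MvPowerSeries.coeff_expand_smul, frobenius_def]

theorem coeff_pow_char_of_not_dvd [Finite σ] (u : MvPowerSeries σ K) {m : σ →₀ ℕ} {i : σ}
    (h : ¬ p ∣ m i) : MvPowerSeries.coeff m (u ^ p) = 0 := by
  rw [← MvPowerSeries.map_frobenius_expand p (Fact.out : p.Prime).ne_zero, MvPowerSeries.coeff_map,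
    MvPowerSeries.coeff_expand_of_not_dvd p _ _ h, map_zero]

variable [PerfectRing K p]

/-- The section operator `∑ a(m) t^m ↦ ∑ a(p m + r)^{1/p} t^m`. -/
noncomputable def sect (r : σ →₀ ℕ) : MvPowerSeries σ K →+ MvPowerSeries σ K where
  toFun w := fun m => (frobeniusEquiv K p).symm (MvPowerSeries.coeff (p • m + r) w)
  map_zero' := by ext m; exact map_zero (frobeniusEquiv K p).symm
  map_add' a b := by ext m; exact map_add (frobeniusEquiv K p).symm _ _

theorem coeff_sect (r m : σ →₀ ℕ) (w : MvPowerSeries σ K) :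
    MvPowerSeries.coeff m (sect p r w) =
      (frobeniusEquiv K p).symm (MvPowerSeries.coeff (p • m + r) w) := rfl

theorem coeff_sect_pow (r m : σ →₀ ℕ) (w : MvPowerSeries σ K) :
    MvPowerSeries.coeff m (sect p r w) ^ p = MvPowerSeries.coeff (p • m + r) w := by
  rw [coeff_sect, frobeniusEquiv_symm_pow_p]

theorem sect_pow_mul [Finite σ] {r : σ →₀ ℕ} (hr : ∀ i, r i < p) (u w : MvPowerSeries σ K) :
    sect p r (u ^ p * w) = u * sect p r w := by
  classical
  have hp : 0 < p := (Fact.out : p.Prime).pos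
  ext m
  rw [coeff_sect, MvPowerSeries.coeff_mul, MvPowerSeries.coeff_mul, map_sum]
  symm
  refine Finset.sum_of_injOn (fun x => (p • x.1, p • x.2 + r)) ?_ ?_ ?_ ?_
  · rintro ⟨a, b⟩ - ⟨c, e⟩ - h
    simp only [Prod.mk.injEq, add_left_inj] at h
    ext i
    · simpa [hp.ne'] using DFunLike.congr_fun h.1 i
    · simpa [hp.ne'] using DFunLike.congr_fun h.2 i
  · rintro ⟨a, b⟩ h
    have h := Finset.HasAntidiagonal.mem_antidiagonal.mp (Finset.mem_coe.mp h)
    refine Finset.mem_coe.mpr (Finset.HasAntidiagonal.mem_antidiagonal.mpr ?_)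
    rw [← h, smul_add, add_assoc]
  · rintro ⟨a, b⟩ h h'
    simp only [Finset.HasAntidiagonal.mem_antidiagonal] at h
    by_cases hd : ∀ i, p ∣ a i
    · exfalso
      apply h'
      have hm (i) : p * (a i / p) + b i = p * m i + r i := by
        rw [Nat.mul_div_cancel' (hd i)]; simpa using DFunLike.congr_fun h i
      have hle (i) : a i / p ≤ m i := by
        by_contra hlt
        have : p * (m i + 1) ≤ p * (a i / p) := Nat.mul_le_mul_left _ (by omega)
        have := hm i; have := hr i
        rw [mul_add] at *; omega
      refine ⟨(a.mapRange (· / p) (Nat.zero_div p), m - a.mapRange (· / p) (Nat.zero_div p)), ?_, ?_⟩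
      · refine Finset.mem_coe.mpr (Finset.HasAntidiagonal.mem_antidiagonal.mpr ?_)
        ext i; simpa using Nat.add_sub_cancel' (hle i)
      · ext i
        · simpa using Nat.mul_div_cancel' (hd i)
        · simp only [Finsupp.coe_add, Finsupp.coe_smul, Finsupp.coe_tsub, Pi.add_apply,
            Pi.smul_apply, Pi.sub_apply, Finsupp.mapRange_apply, smul_eq_mul, Nat.mul_sub]
          have := hm i; have := Nat.mul_le_mul_left p (hle i); omega
    · push Not at hd
      obtain ⟨i, hi⟩ := hd
      rw [coeff_pow_char_of_not_dvd p u hi, zero_mul, map_zero]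
  · rintro ⟨a, b⟩ -
    rw [map_mul, coeff_smul_pow_char, frobeniusEquiv_symm_pow, coeff_sect]

theorem sect_smul (r : σ →₀ ℕ) (c : K)
    (w : MvPowerSeries σ K) : sect p r (c • w) = (frobeniusEquiv K p).symm c • sect p r w := by
  ext m
  simp [coeff_sect]

/-- The exponents `r` with `0 ≤ r_i < p`. -/
noncomputable def digit {p n : ℕ} (r : Fin n → Fin p) : Fin n →₀ ℕ :=
  Finsupp.equivFunOnFinite.symm fun i => r i

theorem digit_lt {p n : ℕ} (r : Fin n → Fin p) (i : Fin n) : digit r i < p := (r i).2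

theorem eq_sum_sect {n : ℕ} (w : MvPowerSeries (Fin n) K) :
    w = ∑ r : Fin n → Fin p, MvPowerSeries.monomial (digit r) 1 * sect p (digit r) w ^ p := by
  classical
  have hp : 0 < p := (Fact.out : p.Prime).pos
  ext m
  rw [map_sum]
  rw [Finset.sum_eq_single (fun i => ⟨m i % p, Nat.mod_lt _ hp⟩)]
  · have hle : digit (fun i => (⟨m i % p, Nat.mod_lt _ hp⟩ : Fin p)) ≤ m :=
      fun i => Nat.mod_le _ _
    rw [MvPowerSeries.coeff_monomial_mul, if_pos hle, one_mul]
    have : m - digit (fun i => (⟨m i % p, Nat.mod_lt _ hp⟩ : Fin p)) =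
        p • m.mapRange (· / p) (Nat.zero_div p) := by
      ext i
      simp only [digit, Finsupp.coe_tsub, Pi.sub_apply, Finsupp.equivFunOnFinite_symm_apply_apply, Finsupp.coe_smul,
        Pi.smul_apply, Finsupp.mapRange_apply, smul_eq_mul]
      have := Nat.div_add_mod (m i) p; omega
    rw [this, coeff_smul_pow_char, coeff_sect_pow, ← this, tsub_add_cancel_of_le hle]
  · intro r _ hr
    rw [MvPowerSeries.coeff_monomial_mul]
    split_ifs with hle
    · rw [one_mul]
      obtain ⟨i, hi⟩ : ∃ i, ¬ p ∣ (m - digit r) i := by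
        by_contra! hall
        apply hr
        ext i
        obtain ⟨c, hc⟩ := hall i
        have h1 : m i = p * c + r i := by
          have := hle i
          simp only [digit, Finsupp.coe_tsub, Pi.sub_apply,
            Finsupp.equivFunOnFinite_symm_apply_apply] at hc this
          omega
        simp [h1, Nat.mod_eq_of_lt (r i).2]
      exact coeff_pow_char_of_not_dvd p _ hi
    · rfl
  · simp

theorem exists_sect_ne_zero {n : ℕ} {w : MvPowerSeries (Fin n) K} (hw : w ≠ 0) :
    ∃ r : Fin n → Fin p, sect p (digit r) w ≠ 0 := by
  by_contra! h
  apply hw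
  rw [eq_sum_sect p w]
  simp [h, (Fact.out : p.Prime).ne_zero]

/-- The section operator on polynomials. -/
noncomputable def polySect (r : σ →₀ ℕ) (c : MvPolynomial σ K) : MvPolynomial σ K :=
  ∑ m ∈ (c.support.preimage (fun m => p • m + r) fun _ _ _ _ h =>
      nsmul_right_injective (Fact.out : p.Prime).ne_zero (add_right_cancel h)),
    MvPolynomial.monomial m ((frobeniusEquiv K p).symm (c.coeff (p • m + r)))

theorem coeff_polySect (r m : σ →₀ ℕ) (c : MvPolynomial σ K) :
    (polySect p r c).coeff m = (frobeniusEquiv K p).symm (c.coeff (p • m + r)) := by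
  classical
  rw [polySect, MvPolynomial.coeff_sum]
  simp only [MvPolynomial.coeff_monomial]
  rw [Finset.sum_ite_eq']
  split_ifs with h
  · rfl
  · have h' : p • m + r ∉ c.support := fun hm => h (Finset.mem_preimage.mpr hm)
    rw [MvPolynomial.notMem_support_iff.mp h', map_zero]

theorem coe_polySect (r : σ →₀ ℕ) (c : MvPolynomial σ K) :
    (polySect p r c : MvPowerSeries σ K) = sect p r c := by
  ext m
  rw [MvPolynomial.coeff_coe, coeff_polySect, coeff_sect, MvPolynomial.coeff_coe]

theorem sect_hadamard {n : ℕ} (r : Fin n →₀ ℕ) (f g : MvPowerSeries (Fin n) K) :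
    sect p r (hadamard f g) = hadamard (sect p r f) (sect p r g) := by
  ext m
  exact map_mul (frobeniusEquiv K p).symm _ _

end Sections
section MinimalAnnihilator

/-- If `v` is a degree function on a domain `R`, then the supremum of `v` over the coefficients of a
polynomial does not decrease under multiplication by a nonzero polynomial. -/
theorem sup_coeff_le_sup_coeff_mul {R : Type*} [CommRing R] [IsDomain R] (v : R → ℕ)
    (hv0 : v 0 = 0) (hadd : ∀ a b, v (a + b) ≤ max (v a) (v b)) (hneg : ∀ a, v (-a) = v a)
    (hmul : ∀ a b, a ≠ 0 → b ≠ 0 → v (a * b) = v a + v b) (A Q : R[X]) (hQ : Q ≠ 0) :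
    (A.support.sup fun j => v (A.coeff j)) ≤ (A * Q).support.sup fun j => v ((A * Q).coeff j) := by
  classical
  set a := A.support.sup fun j => v (A.coeff j) with ha
  set b := Q.support.sup fun j => v (Q.coeff j) with hb
  rcases Nat.eq_zero_or_pos a with h0 | hpos
  · omega
  have hle {P : R[X]} (j : ℕ) : v (P.coeff j) ≤ P.support.sup fun j => v (P.coeff j) := by
    by_cases h : j ∈ P.support
    · exact Finset.le_sup (f := fun j => v (P.coeff j)) h
    · rw [notMem_support_iff.mp h, hv0]; exact Nat.zero_le _
  have key {P : R[X]} (hP : P ≠ 0) : ∃ j, P.coeff j ≠ 0 ∧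
      v (P.coeff j) = (P.support.sup fun j => v (P.coeff j)) ∧
      ∀ i, j < i → P.coeff i = 0 ∨ v (P.coeff i) < P.support.sup fun j => v (P.coeff j) := by
    obtain ⟨j₀, hj₀, hj₀'⟩ := Finset.exists_mem_eq_sup P.support
      (support_nonempty.mpr hP) fun j => v (P.coeff j)
    set T := P.support.filter fun j => v (P.coeff j) = P.support.sup fun j => v (P.coeff j) with hT
    have hTn : T.Nonempty := ⟨j₀, Finset.mem_filter.mpr ⟨hj₀, hj₀'.symm⟩⟩
    have hm := Finset.mem_filter.mp (T.max'_mem hTn)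
    refine ⟨T.max' hTn, mem_support_iff.mp hm.1, hm.2, fun i hi => ?_⟩
    by_contra! hc
    have : i ∈ T := Finset.mem_filter.mpr ⟨mem_support_iff.mpr hc.1, le_antisymm (hle i) hc.2⟩
    exact absurd (T.le_max' i this) (by omega)
  have hA : A ≠ 0 := by rintro rfl; simp [ha] at hpos
  obtain ⟨j, hj0, hja, hj⟩ := key hA
  obtain ⟨l, hl0, hlb, hl⟩ := key hQ
  rw [← ha] at hja hj
  rw [← hb] at hlb hl
  have hsum : ∀ (s : Finset (ℕ × ℕ)) (F : ℕ × ℕ → R), (∀ x ∈ s, v (F x) < a + b) →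
      v (∑ x ∈ s, F x) < a + b := by
    intro s F
    induction s using Finset.induction_on with
    | empty => intro _; rw [Finset.sum_empty, hv0]; omega
    | insert x s hx ih =>
      intro h
      rw [Finset.sum_insert hx]
      exact (hadd _ _).trans_lt (max_lt (h x (Finset.mem_insert_self _ _))
        (ih fun y hy => h y (Finset.mem_insert_of_mem hy)))
  have hrest : v (∑ x ∈ (Finset.HasAntidiagonal.antidiagonal (j + l)).erase (j, l),
      A.coeff x.1 * Q.coeff x.2) < a + b := by
    apply hsum
    rintro ⟨i, m⟩ hx
    simp only [Finset.mem_erase, Finset.HasAntidiagonal.mem_antidiagonal, ne_eq, Prod.mk.injEq] at hx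
    by_cases hi : A.coeff i = 0
    · rw [hi, zero_mul, hv0]; omega
    by_cases hm : Q.coeff m = 0
    · rw [hm, mul_zero, hv0]; omega
    rw [hmul _ _ hi hm]
    have h1 : v (A.coeff i) ≤ a := hle i
    have h2 : v (Q.coeff m) ≤ b := hle m
    rcases lt_trichotomy i j with h | h | h
    · have := (hl m (by omega)).resolve_left hm; omega
    · exact absurd ⟨h, by omega⟩ hx.1
    · have := (hj i h).resolve_left hi; omega
  have hmain : a + b ≤ v ((A * Q).coeff (j + l)) := by
    rw [coeff_mul, ← Finset.add_sum_erase _ _ (Finset.HasAntidiagonal.mem_antidiagonal.mpr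
      (rfl : ((j, l) : ℕ × ℕ).1 + ((j, l) : ℕ × ℕ).2 = j + l))]
    set rest := ∑ x ∈ (Finset.HasAntidiagonal.antidiagonal (j + l)).erase (j, l), A.coeff x.1 * Q.coeff x.2
    by_contra! hc
    have h1 := hadd (A.coeff j * Q.coeff l + rest) (-rest)
    rw [hneg, add_neg_cancel_right, hmul _ _ hj0 hl0, hja, hlb] at h1
    exact absurd h1 (not_le.mpr (max_lt hc hrest))
  exact (Nat.le_add_right a b).trans (hmain.trans (hle _))

variable {K : Type*} [Field K] {n : ℕ}

theorem degT_le_degT_mul (i : Fin n) (A Q : (MvPolynomial (Fin n) K)[X]) (hQ : Q ≠ 0) :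
    degT i A ≤ degT i (A * Q) := by
  refine sup_coeff_le_sup_coeff_mul (fun a => MvPolynomial.degreeOf i a) ?_ ?_ ?_ ?_ A Q hQ
  · exact MvPolynomial.degreeOf_zero i
  · exact fun a b => MvPolynomial.degreeOf_add_le i a b
  · exact fun a => MvPolynomial.degreeOf_neg i a
  · exact fun a b ha hb => MvPolynomial.degreeOf_mul_eq ha hb

theorem totalDegT_le_totalDegT_mul (A Q : (MvPolynomial (Fin n) K)[X]) (hQ : Q ≠ 0) :
    totalDegT A ≤ totalDegT (A * Q) := by
  refine sup_coeff_le_sup_coeff_mul (fun a => MvPolynomial.totalDegree a) ?_ ?_ ?_ ?_ A Q hQ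
  · exact MvPolynomial.totalDegree_zero
  · exact fun a b => MvPolynomial.totalDegree_add a b
  · exact fun a => MvPolynomial.totalDegree_neg a
  · exact fun a b ha hb => MvPolynomial.totalDegree_mul_of_isDomain ha hb

/-- The annihilator ideal of an algebraic element over a UFD is generated by a polynomial of
positive degree. -/
theorem exists_annihilator_dvd {R S : Type*} [CommRing R] [IsDomain R] [UniqueFactorizationMonoid R]
    [CommRing S] [IsDomain S] [Algebra R S] [FaithfulSMul R S] {f : S} (hf : IsAlgebraic R f) :
    ∃ A : R[X], A ≠ 0 ∧ aeval f A = 0 ∧ 0 < A.natDegree ∧ ∀ B : R[X], aeval f B = 0 → A ∣ B := by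
  classical
  have hinj := FaithfulSMul.algebraMap_injective R S
  have hposdeg {B : R[X]} (hB : B ≠ 0) (hBf : aeval f B = 0) : 0 < B.natDegree := by
    by_contra! h
    rw [eq_C_of_natDegree_le_zero h, aeval_C] at hBf
    rw [eq_C_of_natDegree_le_zero h, hinj (hBf.trans (map_zero _).symm), C_0] at hB
    exact hB rfl
  obtain ⟨M, ⟨hM0, hMf⟩, hmin⟩ := exists_minimalFor_of_wellFoundedLT
    (fun A : R[X] => A ≠ 0 ∧ aeval f A = 0) natDegree hf
  have hmin' {B : R[X]} (hB : B ≠ 0) (hBf : aeval f B = 0) : M.natDegree ≤ B.natDegree := by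
    by_contra! h
    exact absurd (hmin ⟨hB, hBf⟩ h.le) (by omega)
  obtain ⟨A, hAM, hAf, hAp⟩ : ∃ A, A ∣ M ∧ aeval f A = 0 ∧ Prime A := by
    obtain ⟨s, hs, u, hu⟩ := UniqueFactorizationMonoid.exists_prime_factors M hM0
    have : (s.map (aeval f)).prod = 0 := by
      have h1 : aeval f s.prod * aeval f (u : R[X]) = 0 := by rw [← map_mul, hu, hMf]
      rw [← map_multiset_prod]
      exact (mul_eq_zero.mp h1).resolve_right ((u.isUnit.map (aeval f)).ne_zero)
    obtain ⟨A, hA, hAf⟩ := Multiset.mem_map.mp (Multiset.prod_eq_zero_iff.mp this)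
    exact ⟨A, (Multiset.dvd_prod hA).trans ⟨u, hu.symm⟩, hAf, hs A hA⟩
  have hA0 := hAp.ne_zero
  have hApos := hposdeg hA0 hAf
  have hAM' := natDegree_le_of_dvd hAM hM0
  refine ⟨A, hA0, hAf, hApos, fun B hB => ?_⟩
  induction h : B.natDegree using Nat.strong_induction_on generalizing B with
  | _ m ih =>
  by_cases hB0 : B = 0
  · rw [hB0]; exact dvd_zero A
  have hAB : A.natDegree ≤ B.natDegree := hAM'.trans (hmin' hB0 hB)
  set B' := C A.leadingCoeff * B - C B.leadingCoeff * X ^ (B.natDegree - A.natDegree) * A with hB'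
  have hlA : A.leadingCoeff ≠ 0 := leadingCoeff_ne_zero.mpr hA0
  have hlB : B.leadingCoeff ≠ 0 := leadingCoeff_ne_zero.mpr hB0
  have hdeg : B'.natDegree < m := by
    have h1 : B'.natDegree ≤ m := by
      refine (natDegree_sub_le _ _).trans (max_le ?_ ?_)
      · exact (natDegree_C_mul_le _ _).trans h.le
      · refine natDegree_mul_le.trans ?_
        have := natDegree_C_mul_X_pow_le B.leadingCoeff (B.natDegree - A.natDegree)
        omega
    refine lt_of_le_of_ne h1 fun heq => ?_
    have h2 : B'.coeff m = 0 := by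
      have h3 : m = A.natDegree + (B.natDegree - A.natDegree) := by omega
      rw [hB', coeff_sub, coeff_C_mul, mul_assoc, coeff_C_mul]
      nth_rewrite 2 [h3]
      rw [coeff_X_pow_mul, ← h, coeff_natDegree, coeff_natDegree, mul_comm, sub_self]
    rw [← heq, coeff_natDegree, leadingCoeff_eq_zero] at h2
    rw [h2] at heq
    simp at heq
    omega
  have hdvd : A ∣ B' := ih _ hdeg B' (by simp [hB', hB, hAf]) rfl
  have hdvd' : A ∣ C A.leadingCoeff * B := by
    rw [← sub_add_cancel (C A.leadingCoeff * B)
      (C B.leadingCoeff * X ^ (B.natDegree - A.natDegree) * A)]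
    exact dvd_add hdvd (dvd_mul_left _ _)
  refine (hAp.dvd_or_dvd hdvd').resolve_left fun hc => ?_
  have := natDegree_le_of_dvd hc (C_ne_zero.mpr hlA)
  rw [natDegree_C] at this
  omega

end MinimalAnnihilator
section StableSubspace

theorem eval_hasseDeriv_mul_pow {S : Type*} [CommRing S] {A : S[X]} {f : S} (hA : A.eval f = 0)
    (P : S[X]) (e : ℕ) :
    (hasseDeriv e (P * A ^ e)).eval f = P.eval f * (derivative A).eval f ^ e := by
  obtain ⟨B, hB⟩ : X ∣ taylor f A := by rw [X_dvd_iff, taylor_coeff_zero, hA]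
  have hB0 : B.coeff 0 = (derivative A).eval f := by
    rw [← taylor_coeff_one, hB, coeff_X_mul]
  rw [← taylor_coeff, taylor_mul, taylor_pow, hB, mul_pow, mul_left_comm]
  rw [coeff_X_pow_mul', if_pos le_rfl, Nat.sub_self, mul_coeff_zero, taylor_coeff_zero, coeff_zero_eq_eval_zero (B ^ e), eval_pow,
    ← coeff_zero_eq_eval_zero, hB0]

variable {K : Type*} [Field K] (p : ℕ) [Fact p.Prime] [CharP K p] {n : ℕ}

instance : CharP (MvPowerSeries (Fin n) K) p :=
  charP_of_injective_algebraMap (FaithfulSMul.algebraMap_injective K _) p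

theorem natCast_choose_pred {S : Type*} [CommRing S] [CharP S p] (m : ℕ) :
    ((m.choose (p - 1) : ℕ) : S) = if m % p = p - 1 then 1 else 0 := by
  have hp : 0 < p := (Fact.out : p.Prime).pos
  have h := Choose.choose_modEq_choose_mod_mul_choose_div_nat (p := p) (n := m) (k := p - 1)
  rw [Nat.mod_eq_of_lt (by omega : p - 1 < p), Nat.div_eq_of_lt (by omega : p - 1 < p),
    Nat.choose_zero_right, mul_one] at h
  rw [(CharP.natCast_eq_natCast S p).mpr h]
  split_ifs with hm
  · rw [hm, Nat.choose_self, Nat.cast_one]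
  · have := Nat.mod_lt m hp
    rw [Nat.choose_eq_zero_of_lt (by omega), Nat.cast_zero]

variable [PerfectRing K p]

theorem sect_eval_hasseDeriv {r : Fin n →₀ ℕ} (hr : ∀ i, r i < p)
    (G : (MvPowerSeries (Fin n) K)[X]) (f : MvPowerSeries (Fin n) K) :
    sect p r ((hasseDeriv (p - 1) G).eval f) =
      ∑ m ∈ G.support with m % p = p - 1, sect p r (G.coeff m) * f ^ (m / p) := by
  rw [hasseDeriv_apply, sum_def, eval_finsetSum, map_sum, Finset.sum_filter]
  refine Finset.sum_congr rfl fun m _ => ?_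
  rw [eval_monomial, natCast_choose_pred p]
  split_ifs with h
  · have h1 : m - (p - 1) = m / p * p := by
      have := Nat.div_add_mod' m p
      omega
    rw [one_mul, h1, pow_mul, mul_comm, sect_pow_mul p hr, mul_comm]
  · rw [zero_mul, zero_mul, map_zero]

theorem algebraMap_eq_coe (c : MvPolynomial (Fin n) K) :
    algebraMap (MvPolynomial (Fin n) K) (MvPowerSeries (Fin n) K) c = c := by
  rw [MvPowerSeries.algebraMap_apply']
  simp

instance : FaithfulSMul (MvPolynomial (Fin n) K) (MvPowerSeries (Fin n) K) := by
  rw [faithfulSMul_iff_algebraMap_injective]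
  intro a b h
  rw [algebraMap_eq_coe, algebraMap_eq_coe] at h
  exact MvPolynomial.coe_injective _ _ h

instance : IsScalarTower K (MvPolynomial (Fin n) K) (MvPowerSeries (Fin n) K) :=
  IsScalarTower.of_algebraMap_eq fun c => by
    rw [algebraMap_eq_coe, MvPolynomial.algebraMap_eq, MvPolynomial.coe_C]; rfl

/-- Over a perfect field, algebraic power series are separable. -/
theorem aeval_derivative_ne_zero (p : ℕ) [Fact p.Prime] [CharP K p]
    [PerfectRing K p] {f : MvPowerSeries (Fin n) K} {A : (MvPolynomial (Fin n) K)[X]}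
    (hA : A ≠ 0) (hAf : aeval f A = 0) (hpos : 0 < A.natDegree)
    (hdvd : ∀ B : (MvPolynomial (Fin n) K)[X], aeval f B = 0 → A ∣ B) :
    aeval f (derivative A) ≠ 0 := by
  intro h0
  have hp : p.Prime := Fact.out
  have hmin {B : (MvPolynomial (Fin n) K)[X]} (hB : aeval f B = 0)
      (hlt : B.natDegree < A.natDegree) : B = 0 := by
    by_contra hne
    exact absurd (natDegree_le_of_dvd (hdvd B hB) hne) (by omega)
  have hder : derivative A = 0 := hmin h0 (natDegree_derivative_lt hpos.ne')
  set B := contract p A with hB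
  have hBA : expand _ p B = A := expand_contract p hder hp.ne_zero
  have hdeg : B.natDegree < A.natDegree := by
    have h1 : A.natDegree = B.natDegree * p := by rw [← hBA, natDegree_expand]
    have := hp.two_le
    nlinarith
  have hBne : B ≠ 0 := by
    rintro h; rw [h, map_zero] at hBA; exact hA hBA.symm
  have hBf : ∑ j ∈ Finset.range (B.natDegree + 1), (f ^ j) ^ p * (B.coeff j : MvPowerSeries (Fin n) K) = 0 := by
    rw [← hBA, expand_aeval, aeval_eq_sum_range] at hAf
    rw [← hAf]
    refine Finset.sum_congr rfl fun j _ => ?_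
    rw [Algebra.smul_def, algebraMap_eq_coe, mul_comm, pow_right_comm]
  have hcoef (r : Fin n → Fin p) (j : ℕ) (hj : j ∈ Finset.range (B.natDegree + 1)) :
      polySect p (digit r) (B.coeff j) = 0 := by
    set Q : (MvPolynomial (Fin n) K)[X] := ∑ j ∈ Finset.range (B.natDegree + 1),
      C (polySect p (digit r) (B.coeff j)) * X ^ j with hQ
    have hQ0 : Q = 0 := by
      apply hmin
      · have := congrArg (sect p (digit r)) hBf
        rw [map_sum, map_zero] at this
        rw [← this, hQ, map_sum]
        refine Finset.sum_congr rfl fun j _ => ?_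
        rw [sect_pow_mul p (digit_lt r), map_mul, aeval_C, map_pow, aeval_X, algebraMap_eq_coe,
          coe_polySect, mul_comm]
      · refine lt_of_le_of_lt (natDegree_sum_le_of_forall_le _ _ fun j hj => ?_) hdeg
        exact (natDegree_C_mul_X_pow_le _ _).trans (Nat.lt_succ_iff.mp (Finset.mem_range.mp hj))
    have := congrArg (coeff · j) hQ0
    simpa [hQ, finsetSum_coeff, coeff_C_mul, coeff_X_pow, Finset.mem_range.mp hj] using this
  apply hBne
  ext1 j
  rw [coeff_zero]
  by_cases hj : j ∈ Finset.range (B.natDegree + 1)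
  · by_contra hne
    obtain ⟨r, hr⟩ := exists_sect_ne_zero p
      (w := (B.coeff j : MvPowerSeries (Fin n) K)) (by rwa [Ne, MvPolynomial.coe_eq_zero_iff])
    rw [← coe_polySect, hcoef r j hj] at hr
    exact hr MvPolynomial.coe_zero
  · exact coeff_eq_zero_of_natDegree_lt (by simpa using hj)

section Box

variable {ι : Type*} (ℓ : ι → (Fin n →₀ ℕ) →+ ℕ) (b : ι → ℕ)

/-- The polynomials in `t` all of whose monomials `m` satisfy `ℓ i m ≤ N b i` for all `i`. -/
def box (N : ℕ) : Submodule K (MvPolynomial (Fin n) K) where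
  carrier := {c | ∀ m, c.coeff m ≠ 0 → ∀ i, ℓ i m ≤ N * b i}
  zero_mem' := fun m hm => absurd (MvPolynomial.coeff_zero m) hm
  add_mem' := fun {c c'} hc hc' m hm => by
    by_cases h : c.coeff m = 0
    · refine hc' m fun h' => hm ?_
      rw [MvPolynomial.coeff_add, h, h', add_zero]
    · exact hc m h
  smul_mem' := fun x c hc m hm => hc m fun h => hm (by rw [MvPolynomial.coeff_smul, h, smul_zero])

/-- The polynomials in `y` of degree at most `N d` with coefficients in `box ℓ b N`. -/
def polyBox (d N : ℕ) : Submodule K (MvPolynomial (Fin n) K)[X] where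
  carrier := {P | P.natDegree ≤ N * d ∧ ∀ j, P.coeff j ∈ box (K := K) ℓ b N}
  zero_mem' := ⟨by simp, fun j => by rw [coeff_zero]; exact zero_mem _⟩
  add_mem' := fun hP hQ => ⟨(natDegree_add_le _ _).trans (max_le hP.1 hQ.1),
    fun j => by rw [coeff_add]; exact add_mem (hP.2 j) (hQ.2 j)⟩
  smul_mem' := fun x P hP => ⟨(natDegree_smul_le _ _).trans hP.1,
    fun j => by rw [coeff_smul]; exact Submodule.smul_mem _ _ (hP.2 j)⟩

variable {ℓ b}

theorem mul_mem_box {M N : ℕ} {c c' : MvPolynomial (Fin n) K} (hc : c ∈ box ℓ b M)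
    (hc' : c' ∈ box ℓ b N) : c * c' ∈ box ℓ b (M + N) := by
  classical
  intro m hm i
  rw [MvPolynomial.coeff_mul] at hm
  obtain ⟨x, hx, hne⟩ := Finset.exists_ne_zero_of_sum_ne_zero hm
  rw [← Finset.HasAntidiagonal.mem_antidiagonal.mp hx, map_add, add_mul]
  exact add_le_add (hc _ (left_ne_zero_of_mul hne) i) (hc' _ (right_ne_zero_of_mul hne) i)

theorem mul_mem_polyBox {d M N : ℕ} {P Q : (MvPolynomial (Fin n) K)[X]}
    (hP : P ∈ polyBox ℓ b d M) (hQ : Q ∈ polyBox ℓ b d N) : P * Q ∈ polyBox ℓ b d (M + N) := by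
  refine ⟨natDegree_mul_le.trans ((add_le_add hP.1 hQ.1).trans_eq (add_mul _ _ _).symm),
    fun j => ?_⟩
  rw [coeff_mul]
  exact sum_mem fun x _ => mul_mem_box (hP.2 _) (hQ.2 _)

theorem mul_pow_mem_polyBox {d : ℕ} {P A : (MvPolynomial (Fin n) K)[X]}
    (hP : P ∈ polyBox ℓ b d 1) (hA : A ∈ polyBox ℓ b d 1) (e : ℕ) :
    P * A ^ e ∈ polyBox ℓ b d (e + 1) := by
  induction e with
  | zero => simpa using hP
  | succ e ih => rw [pow_succ, ← mul_assoc]; exact mul_mem_polyBox ih hA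

theorem polySect_mem_box {c : MvPolynomial (Fin n) K} (hc : c ∈ box ℓ b p) (r : Fin n →₀ ℕ) :
    polySect p r c ∈ box ℓ b 1 := by
  intro m hm i
  rw [coeff_polySect] at hm
  have h := hc (p • m + r) (fun h => hm (by rw [h, map_zero])) i
  rw [map_add, map_nsmul, smul_eq_mul] at h
  rw [one_mul]
  exact Nat.le_of_mul_le_mul_left ((Nat.le_add_right _ _).trans h) (Fact.out : p.Prime).pos

variable (ℓ b)

/-- The values `P(f)` for `P` in the box. -/
noncomputable def boxValues (d : ℕ) (f : MvPowerSeries (Fin n) K) : Submodule K (MvPowerSeries (Fin n) K) :=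
  (polyBox ℓ b d 1).map ((aeval (R := MvPolynomial (Fin n) K) f).toLinearMap.restrictScalars K)

/-- The power series of the form `P(f) / A'(f)` for `P` in the box. -/
noncomputable def stableSpace (d : ℕ) (A : (MvPolynomial (Fin n) K)[X])
    (f : MvPowerSeries (Fin n) K) : Submodule K (MvPowerSeries (Fin n) K) :=
  (boxValues ℓ b d f).comap (LinearMap.mulLeft K (aeval f (derivative A)))

variable {ℓ b}

theorem mem_stableSpace {d : ℕ} {A : (MvPolynomial (Fin n) K)[X]} {f w : MvPowerSeries (Fin n) K} :
    w ∈ stableSpace ℓ b d A f ↔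
      ∃ P ∈ polyBox (K := K) ℓ b d 1, aeval f P = aeval f (derivative A) * w := Iff.rfl

theorem self_mem_stableSpace {d : ℕ} {A : (MvPolynomial (Fin n) K)[X]}
    (hA : A ∈ polyBox ℓ b d 1) (f : MvPowerSeries (Fin n) K) : f ∈ stableSpace ℓ b d A f := by
  refine mem_stableSpace.mpr ⟨X * derivative A, ⟨?_, fun j => ?_⟩, by
    rw [map_mul, aeval_X, mul_comm]⟩
  · refine le_trans ?_ hA.1
    by_cases h : A.natDegree = 0
    · rw [eq_C_of_natDegree_eq_zero h]; simp
    · have h1 := natDegree_derivative_lt h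
      have h2 := natDegree_mul_le (p := X) (q := derivative A)
      rw [natDegree_X] at h2
      omega
  · cases j with
    | zero => rw [coeff_X_mul_zero]; exact zero_mem _
    | succ j =>
      rw [coeff_X_mul, coeff_derivative, mul_comm]
      have := Submodule.smul_mem _ ((j + 1 : ℕ) : K) (hA.2 (j + 1))
      rwa [Algebra.smul_def, map_natCast, Nat.cast_add, Nat.cast_one] at this

theorem sect_mem_stableSpace {d : ℕ} {A : (MvPolynomial (Fin n) K)[X]}
    (hA : A ∈ polyBox ℓ b d 1) {f : MvPowerSeries (Fin n) K} (hAf : aeval f A = 0)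
    {r : Fin n →₀ ℕ} (hr : ∀ i, r i < p)
    {w : MvPowerSeries (Fin n) K} (hw : w ∈ stableSpace ℓ b d A f) :
    sect p r w ∈ stableSpace ℓ b d A f := by
  have hp : 0 < p := (Fact.out : p.Prime).pos
  obtain ⟨P, hP, hPw⟩ := mem_stableSpace.mp hw
  set φ := algebraMap (MvPolynomial (Fin n) K) (MvPowerSeries (Fin n) K) with hφ
  set G := P * A ^ (p - 1) with hG
  have hGbox : G ∈ polyBox ℓ b d p := by
    have := mul_pow_mem_polyBox hP hA (p - 1)
    rwa [Nat.sub_add_cancel hp] at this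
  have key : (hasseDeriv (p - 1) (G.map φ)).eval f = aeval f (derivative A) ^ p * w := by
    rw [hG, Polynomial.map_mul, Polynomial.map_pow, eval_hasseDeriv_mul_pow, derivative_map,
      eval_map_algebraMap, eval_map_algebraMap, hPw]
    · rw [← mul_pow_sub_one hp.ne' (aeval f (derivative A))]; ring
    · rw [eval_map_algebraMap, hAf]
  have h := congrArg (sect p r) key
  rw [sect_pow_mul p hr, sect_eval_hasseDeriv p hr] at h
  refine mem_stableSpace.mpr
    ⟨∑ m ∈ (G.map φ).support with m % p = p - 1, C (polySect p r (G.coeff m)) * X ^ (m / p), ?_, ?_⟩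
  · refine sum_mem fun m _ => ⟨?_, fun j => ?_⟩
    · by_cases hm : G.coeff m = 0
      · have : polySect p r (0 : MvPolynomial (Fin n) K) = 0 := by
          ext x; simp [coeff_polySect]
        simp [hm, this]
      · refine (natDegree_C_mul_X_pow_le _ _).trans ?_
        have := (le_natDegree_of_ne_zero hm).trans hGbox.1
        rw [one_mul]
        exact Nat.div_le_of_le_mul this
    · rw [coeff_C_mul_X_pow]
      split_ifs
      · exact polySect_mem_box p (hGbox.2 m) r
      · exact zero_mem _
  · rw [← h, map_sum]
    refine Finset.sum_congr rfl fun m _ => ?_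
    rw [map_mul, aeval_C, map_pow, aeval_X, algebraMap_eq_coe, coe_polySect, coeff_map, hφ,
      algebraMap_eq_coe]

theorem finrank_stableSpace_le {d : ℕ} {A : (MvPolynomial (Fin n) K)[X]}
    {f : MvPowerSeries (Fin n) K} (hne : aeval f (derivative A) ≠ 0) (s : Finset (Fin n →₀ ℕ))
    (hs : ∀ m, (∀ i, ℓ i m ≤ b i) → m ∈ s) :
    Module.Finite K (stableSpace ℓ b d A f) ∧
      Module.finrank K (stableSpace ℓ b d A f) ≤ (d + 1) * s.card := by
  classical
  set T : Finset (MvPowerSeries (Fin n) K) := (Finset.range (d + 1) ×ˢ s).image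
    fun x => MvPowerSeries.monomial x.2 (1 : K) * f ^ x.1 with hT
  have hle : boxValues ℓ b d f ≤ Submodule.span K (T : Set (MvPowerSeries (Fin n) K)) := by
    rintro _ ⟨P, hP, rfl⟩
    change aeval f P ∈ _
    rw [aeval_eq_sum_range]
    refine sum_mem fun j hj => ?_
    rw [Algebra.smul_def, algebraMap_eq_coe, (P.coeff j).as_sum,
      ← MvPolynomial.coeToMvPowerSeries.ringHom_apply, map_sum, Finset.sum_mul]
    refine sum_mem fun m hm => ?_
    rw [MvPolynomial.coeToMvPowerSeries.ringHom_apply, MvPolynomial.coe_monomial]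
    have hmon : MvPowerSeries.monomial m ((P.coeff j).coeff m) =
        (P.coeff j).coeff m • MvPowerSeries.monomial m (1 : K) := by
      rw [← map_smul, smul_eq_mul, mul_one]
    rw [hmon, smul_mul_assoc]
    refine Submodule.smul_mem _ _ (Submodule.subset_span ?_)
    refine Finset.mem_coe.mpr (Finset.mem_image.mpr ⟨(j, m), Finset.mem_product.mpr ⟨?_, ?_⟩, rfl⟩)
    · have := hP.1
      rw [Finset.mem_range] at hj ⊢
      omega
    · refine hs m fun i => ?_
      have := hP.2 j m (MvPolynomial.mem_support_iff.mp hm) i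
      rwa [one_mul] at this
  have hinj : Function.Injective (LinearMap.mulLeft K (aeval f (derivative A))) :=
    fun x y h => mul_left_cancel₀ hne h
  have hfin : Module.Finite K (Submodule.span K (T : Set (MvPowerSeries (Fin n) K))) :=
    FiniteDimensional.span_finset K T
  have hmap : (stableSpace ℓ b d A f).map (LinearMap.mulLeft K (aeval f (derivative A))) ≤
      Submodule.span K (T : Set (MvPowerSeries (Fin n) K)) :=
    (Submodule.map_comap_le _ _).trans hle
  have e := Submodule.equivMapOfInjective _ hinj (stableSpace ℓ b d A f)
  have hfin' := Submodule.finiteDimensional_of_le hmap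
  refine ⟨Module.Finite.equiv e.symm, ?_⟩
  rw [e.finrank_eq]
  refine (Submodule.finrank_mono hmap).trans ((finrank_span_finset_le_card T).trans ?_)
  refine Finset.card_image_le.trans ?_
  rw [Finset.card_product, Finset.card_range]

end Box

end StableSubspace
section Annihilation

variable {K : Type*} [Field K] (p : ℕ) [Fact p.Prime] [CharP K p] [PerfectRing K p] {n : ℕ}

/-- A subspace stable under all section operators is contained in the span of its `p^i`-th powers. -/
theorem pow_mem_span_pow {W : Submodule K (MvPowerSeries (Fin n) K)}
    (hW : ∀ (r : Fin n → Fin p), ∀ w ∈ W, sect p (digit r) w ∈ W) (i : ℕ) :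
    ∀ (j : ℕ), ∀ w ∈ W, w ^ p ^ j ∈ Submodule.span (MvPolynomial (Fin n) K)
      ((fun u => u ^ p ^ (j + i)) '' (W : Set (MvPowerSeries (Fin n) K))) := by
  induction i with
  | zero => exact fun j w hw => Submodule.subset_span ⟨w, hw, rfl⟩
  | succ i ih =>
    intro j w hw
    rw [eq_sum_sect p w, sum_pow_char_pow]
    refine sum_mem fun r _ => ?_
    rw [mul_pow, ← pow_mul, ← pow_succ', ← MvPolynomial.coe_monomial, ← MvPolynomial.coe_pow,
      ← algebraMap_eq_coe, ← Algebra.smul_def]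
    refine Submodule.smul_mem _ _ ?_
    have := ih (j + 1) _ (hW r w hw)
    rwa [add_assoc, add_comm 1 i] at this

theorem exists_annihilator_of_stable {W : Submodule K (MvPowerSeries (Fin n) K)}
    [Module.Finite K W] (hW : ∀ (r : Fin n → Fin p), ∀ w ∈ W, sect p (digit r) w ∈ W)
    {N : ℕ} (hN : Module.finrank K W ≤ N) (hN2 : 2 ≤ N) {F : MvPowerSeries (Fin n) K}
    (hF : F ∈ W) : ∃ B ∈ annihilators F, B.natDegree ≤ p ^ N - 1 := by
  classical
  have hp : p.Prime := Fact.out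
  by_cases hF0 : F = 0
  · refine ⟨X, ⟨X_ne_zero, by rw [aeval_X, hF0]⟩, ?_⟩
    have h1 : 2 ^ 2 ≤ p ^ N := (Nat.pow_le_pow_left hp.two_le 2).trans
      (Nat.pow_le_pow_right hp.pos hN2)
    rw [natDegree_X]
    omega
  let e := Module.finBasis K W
  set T : Finset (MvPowerSeries (Fin n) K) :=
    Finset.univ.image fun i => (e i : MvPowerSeries (Fin n) K) ^ p ^ N with hT
  have hspan : ∀ w ∈ W, w ^ p ^ N ∈ Submodule.span (MvPolynomial (Fin n) K)
      (T : Set (MvPowerSeries (Fin n) K)) := by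
    intro w hw
    have h1 : w = ∑ i, e.repr ⟨w, hw⟩ i • (e i : MvPowerSeries (Fin n) K) := by
      have := congrArg W.subtype (e.sum_repr ⟨w, hw⟩)
      simp only [map_sum, map_smul, Submodule.subtype_apply] at this
      exact this.symm
    rw [h1, sum_pow_char_pow]
    refine sum_mem fun i _ => ?_
    rw [_root_.smul_pow, ← algebraMap_smul (MvPolynomial (Fin n) K)]
    exact Submodule.smul_mem _ _ (Submodule.subset_span
      (Finset.mem_coe.mpr (Finset.mem_image_of_mem _ (Finset.mem_univ i))))
  have hmem (j : Fin (N + 1)) : F ^ p ^ (j : ℕ) ∈ Submodule.span (MvPolynomial (Fin n) K)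
      (T : Set (MvPowerSeries (Fin n) K)) := by
    have h1 := pow_mem_span_pow p hW (N - j) j F hF
    rw [Nat.add_sub_cancel' (Nat.lt_succ_iff.mp j.2)] at h1
    refine Submodule.span_le.mpr ?_ h1
    rintro _ ⟨u, hu, rfl⟩
    exact hspan u hu
  have hdep : ¬ LinearIndependent (MvPolynomial (Fin n) K) fun j : Fin (N + 1) =>
      F ^ p ^ (j : ℕ) := by
    intro hli
    have h1 := linearIndependent_le_span' _ hli (T : Set (MvPowerSeries (Fin n) K))
      (by rintro _ ⟨j, rfl⟩; exact hmem j)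
    have h2 : T.card ≤ N := (Finset.card_image_le.trans (by simp)).trans hN
    simp only [Cardinal.mk_fin, Finset.coe_sort_coe, Fintype.card_coe, Nat.cast_le] at h1
    omega
  obtain ⟨c, hc, i, hi⟩ := Fintype.not_linearIndependent_iff.mp hdep
  set P : (MvPolynomial (Fin n) K)[X] := ∑ j : Fin (N + 1), C (c j) * X ^ p ^ (j : ℕ) with hP
  have hPcoeff : P.coeff (p ^ (i : ℕ)) = c i := by
    rw [hP, finsetSum_coeff, Finset.sum_eq_single i]
    · rw [coeff_C_mul_X_pow, if_pos rfl]
    · intro j _ hj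
      rw [coeff_C_mul_X_pow, if_neg]
      exact fun h => hj (Fin.ext (Nat.pow_right_injective hp.two_le h.symm))
    · simp
  have hP0 : P.coeff 0 = 0 := by
    rw [hP, finsetSum_coeff]
    refine Finset.sum_eq_zero fun j _ => ?_
    rw [coeff_C_mul_X_pow, if_neg (pow_pos hp.pos _).ne]
  have hPF : aeval F P = 0 := by
    rw [← hc, hP, map_sum]
    refine Finset.sum_congr rfl fun j _ => ?_
    rw [map_mul, aeval_C, map_pow, aeval_X, Algebra.smul_def]
  have hPdeg : P.natDegree ≤ p ^ N :=
    natDegree_sum_le_of_forall_le _ _ fun j _ => (natDegree_C_mul_X_pow_le _ _).trans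
      (Nat.pow_le_pow_right hp.pos (Nat.lt_succ_iff.mp j.2))
  have hdiv : P.divX * X = P := by
    have := divX_mul_X_add P
    rwa [hP0, C_0, add_zero] at this
  refine ⟨P.divX, ⟨fun h => hi ?_, ?_⟩, ?_⟩
  · rw [← hPcoeff, ← hdiv, h, zero_mul, coeff_zero]
  · rw [← hdiv, map_mul, aeval_X] at hPF
    exact (mul_eq_zero.mp hPF).resolve_right hF0
  · rw [natDegree_divX_eq_natDegree_tsub_one]
    exact Nat.sub_le_sub_right hPdeg 1

/-- The Hadamard product as a bilinear map. -/
noncomputable def hadamardBilin (K : Type*) [Field K] (n : ℕ) : MvPowerSeries (Fin n) K →ₗ[K]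
    MvPowerSeries (Fin n) K →ₗ[K] MvPowerSeries (Fin n) K :=
  LinearMap.mk₂ K hadamard (fun _ _ _ => by ext m; exact add_mul _ _ _)
    (fun _ _ _ => by ext m; exact mul_assoc _ _ _) (fun _ _ _ => by ext m; exact mul_add _ _ _)
    (fun _ _ _ => by ext m; exact mul_left_comm _ _ _)

theorem span_range_coe_basis {E ι : Type*} [AddCommGroup E] [Module K E] {V : Submodule K E}
    (e : Module.Basis ι K V) : Submodule.span K (Set.range fun i => (e i : E)) = V := by
  have h := congrArg (Submodule.map V.subtype) e.span_eq
  rw [Submodule.map_span, ← Set.range_comp, Submodule.map_top, Submodule.range_subtype] at h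
  exact h

theorem finrank_map₂_le {E₁ E₂ E₃ : Type*} [AddCommGroup E₁] [AddCommGroup E₂] [AddCommGroup E₃]
    [Module K E₁] [Module K E₂] [Module K E₃] (β : E₁ →ₗ[K] E₂ →ₗ[K] E₃) (V₁ : Submodule K E₁)
    (V₂ : Submodule K E₂) [Module.Finite K V₁] [Module.Finite K V₂] :
    Module.Finite K (Submodule.map₂ β V₁ V₂) ∧ Module.finrank K (Submodule.map₂ β V₁ V₂) ≤
      Module.finrank K V₁ * Module.finrank K V₂ := by
  let e₁ := Module.finBasis K V₁
  let e₂ := Module.finBasis K V₂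
  have h : Submodule.map₂ β V₁ V₂ = Submodule.span K
      (Set.range fun x : Fin (Module.finrank K V₁) × Fin (Module.finrank K V₂) =>
        β (e₁ x.1) (e₂ x.2)) := by
    conv_lhs => rw [← span_range_coe_basis e₁, ← span_range_coe_basis e₂]
    rw [Submodule.map₂_span_span, Set.image2_range]
  rw [h]
  refine ⟨Module.Finite.span_of_finite K (Set.finite_range _), ?_⟩
  refine (finrank_range_le_card _).trans ?_
  simp

theorem sect_mem_map₂_hadamardBilin {V V' : Submodule K (MvPowerSeries (Fin n) K)}
    {r : Fin n →₀ ℕ} (hV : ∀ w ∈ V, sect p r w ∈ V) (hV' : ∀ w ∈ V', sect p r w ∈ V')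
    {w : MvPowerSeries (Fin n) K} (hw : w ∈ Submodule.map₂ (hadamardBilin K n) V V') :
    sect p r w ∈ Submodule.map₂ (hadamardBilin K n) V V' := by
  rw [← Submodule.span_eq V, ← Submodule.span_eq V', Submodule.map₂_span_span] at hw
  induction hw using Submodule.span_induction with
  | mem x hx =>
    obtain ⟨u, hu, v, hv, rfl⟩ := hx
    change sect p r (hadamard u v) ∈ _
    rw [sect_hadamard]
    exact Submodule.apply_mem_map₂ _ (hV u hu) (hV' v hv)
  | zero => rw [map_zero]; exact zero_mem _
  | add x y _ _ hx hy => rw [map_add]; exact add_mem hx hy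
  | smul c x _ hx => rw [sect_smul]; exact Submodule.smul_mem _ _ hx

end Annihilation
section Existence

variable {K : Type*} [Field K] {n : ℕ}

theorem exists_finset_box (b : Fin n → ℕ) : ∃ s : Finset (Fin n →₀ ℕ),
    s.card = ∏ i, (b i + 1) ∧ ∀ m : Fin n →₀ ℕ, (∀ i, Finsupp.applyAddHom i m ≤ b i) → m ∈ s := by
  classical
  refine ⟨(Fintype.piFinset fun i => Finset.range (b i + 1)).map
    Finsupp.equivFunOnFinite.symm.toEmbedding, ?_, fun m hm => ?_⟩
  · simp
  · refine Finset.mem_map.mpr ⟨m, Fintype.mem_piFinset.mpr fun i => ?_, by simp⟩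
    exact Finset.mem_range.mpr (Nat.lt_succ_of_le (hm i))

theorem exists_finset_simplex (h : ℕ) : ∃ s : Finset (Fin n →₀ ℕ),
    s.card ≤ (n + h).choose n ∧ ∀ m : Fin n →₀ ℕ, m.degree ≤ h → m ∈ s := by
  classical
  refine ⟨((Finset.univ : Finset (Fin (n + 1))).finsuppAntidiag h).image Finsupp.tail, ?_,
    fun m hm => ?_⟩
  · refine Finset.card_image_le.trans ?_
    rw [Finset.card_finsuppAntidiag_nat_eq_choose, Finset.card_univ, Fintype.card_fin,
      show n + 1 + h - 1 = n + h by omega, Nat.choose_symm_add]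
  · refine Finset.mem_image.mpr ⟨Finsupp.cons (h - m.degree) m, ?_, Finsupp.tail_cons _ _⟩
    rw [Finset.mem_finsuppAntidiag]
    refine ⟨?_, Finset.subset_univ _⟩
    rw [Fin.sum_univ_succ, Finsupp.cons_zero]
    simp only [Finsupp.cons_succ]
    rw [← Finsupp.degree_eq_sum]
    omega

theorem exists_stable_subspace (p : ℕ) [Fact p.Prime] [CharP K p] [PerfectRing K p]
    {f : MvPowerSeries (Fin n) K} {d h : ℕ} {hp : Fin n → ℕ}
    (hd : ∃ A ∈ annihilators f, A.natDegree ≤ d) (hh : ∃ A ∈ annihilators f, totalDegT A ≤ h)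
    (hhp : ∀ i, ∃ A ∈ annihilators f, degT i A ≤ hp i) :
    ∃ V : Submodule K (MvPowerSeries (Fin n) K), f ∈ V ∧ Module.Finite K V ∧
      Module.finrank K V ≤ dimBound n d h hp ∧
      ∀ (r : Fin n → Fin p), ∀ w ∈ V, sect p (digit r) w ∈ V := by
  have halg : IsAlgebraic (MvPolynomial (Fin n) K) f := by
    obtain ⟨A, hA, -⟩ := hd
    exact ⟨A, hA.1, hA.2⟩
  have : IsDomain (MvPowerSeries (Fin n) K) := NoZeroDivisors.to_isDomain _
  obtain ⟨A, hA0, hAf, hpos, hdvd⟩ := exists_annihilator_dvd halg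
  have hne := aeval_derivative_ne_zero p hA0 hAf hpos hdvd
  have hAd : A.natDegree ≤ d := by
    obtain ⟨B, hB, hle⟩ := hd
    exact (natDegree_le_of_dvd (hdvd B hB.2) hB.1).trans hle
  have hAh : totalDegT A ≤ h := by
    obtain ⟨B, hB, hle⟩ := hh
    obtain ⟨Q, rfl⟩ := hdvd B hB.2
    exact (totalDegT_le_totalDegT_mul A Q (right_ne_zero_of_mul hB.1)).trans hle
  have hAhp (i : Fin n) : degT i A ≤ hp i := by
    obtain ⟨B, hB, hle⟩ := hhp i
    obtain ⟨Q, rfl⟩ := hdvd B hB.2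
    exact (degT_le_degT_mul i A Q (right_ne_zero_of_mul hB.1)).trans hle
  have main {ι : Type} (ℓ : ι → (Fin n →₀ ℕ) →+ ℕ) (b : ι → ℕ) (s : Finset (Fin n →₀ ℕ))
      (hs : ∀ m, (∀ i, ℓ i m ≤ b i) → m ∈ s) (hA : ∀ j, A.coeff j ∈ box (K := K) ℓ b 1) :
      ∃ V : Submodule K (MvPowerSeries (Fin n) K), f ∈ V ∧ Module.Finite K V ∧
        Module.finrank K V ≤ (d + 1) * s.card ∧
        ∀ (r : Fin n → Fin p), ∀ w ∈ V, sect p (digit r) w ∈ V := by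
    have hAbox : A ∈ polyBox (K := K) ℓ b d 1 := ⟨by rwa [one_mul], hA⟩
    obtain ⟨h1, h2⟩ := finrank_stableSpace_le (d := d) hne s hs
    exact ⟨stableSpace ℓ b d A f, self_mem_stableSpace hAbox f, h1, h2,
      fun r w hw => sect_mem_stableSpace p hAbox hAf (digit_lt r) hw⟩
  rcases min_choice (∏ i, (hp i + 1)) ((n + h).choose n) with hmin | hmin
  · obtain ⟨s, hcard, hs⟩ := exists_finset_box hp
    rw [dimBound, hmin, ← hcard]
    refine main (fun i => Finsupp.applyAddHom i) hp s hs fun j m hm i => ?_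
    rw [one_mul]
    refine le_trans ?_ (hAhp i)
    refine (MvPolynomial.monomial_le_degreeOf i (MvPolynomial.mem_support_iff.mpr hm)).trans ?_
    refine Finset.le_sup (f := fun j => (A.coeff j).degreeOf i) (mem_support_iff.mpr ?_)
    intro h0; rw [h0, MvPolynomial.coeff_zero] at hm; exact hm rfl
  · obtain ⟨s, hcard, hs⟩ := exists_finset_simplex (n := n) h
    obtain ⟨V, h1, h2, h3, h4⟩ := main (ι := Unit) (fun _ => Finsupp.degree) (fun _ => h) s
      (fun m hm => hs m (hm ())) fun j m hm i => by
        rw [one_mul]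
        refine le_trans ?_ hAh
        refine (MvPolynomial.le_totalDegree (MvPolynomial.mem_support_iff.mpr hm)).trans ?_
        refine Finset.le_sup (f := fun j => (A.coeff j).totalDegree) (mem_support_iff.mpr ?_)
        intro h0; rw [h0, MvPolynomial.coeff_zero] at hm; exact hm rfl
    refine ⟨V, h1, h2, h3.trans ?_, h4⟩
    rw [dimBound, hmin]
    exact Nat.mul_le_mul_left _ hcard

end Existence

section BaseChange

variable {k K : Type*} [Field k] [Field K] {n : ℕ}

theorem map_mem_annihilators (φ : k →+* K) {f : MvPowerSeries (Fin n) k}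
    {A : (MvPolynomial (Fin n) k)[X]} (hA : A ∈ annihilators f) :
    A.map (MvPolynomial.map φ) ∈ annihilators (MvPowerSeries.map φ f) := by
  refine ⟨(Polynomial.map_ne_zero_iff (MvPolynomial.map_injective φ φ.injective)).mpr hA.1, ?_⟩
  have h := congrArg (MvPowerSeries.map φ) hA.2
  rw [map_zero, aeval_def, hom_eval₂] at h
  rw [aeval_def, eval₂_map, ← h]
  congr 1

theorem degT_map_le (φ : k →+* K) (i : Fin n) (A : (MvPolynomial (Fin n) k)[X]) :
    degT i (A.map (MvPolynomial.map φ)) ≤ degT i A := by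
  refine Finset.sup_le fun j hj => ?_
  have hj' : j ∈ A.support := support_map_subset _ _ hj
  refine le_trans ?_ (Finset.le_sup (f := fun j => (A.coeff j).degreeOf i) hj')
  rw [coeff_map]
  exact MvPolynomial.degreeOf_le_iff.mpr fun m hm =>
    MvPolynomial.monomial_le_degreeOf i (MvPolynomial.support_map_subset _ _ hm)

theorem totalDegT_map_le (φ : k →+* K) (A : (MvPolynomial (Fin n) k)[X]) :
    totalDegT (A.map (MvPolynomial.map φ)) ≤ totalDegT A := by
  refine Finset.sup_le fun j hj => ?_
  have hj' : j ∈ A.support := support_map_subset _ _ hj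
  refine le_trans ?_ (Finset.le_sup (f := fun j => (A.coeff j).totalDegree) hj')
  rw [coeff_map]
  exact Finset.sup_mono (MvPolynomial.support_map_subset _ _)

theorem map_hadamard (φ : k →+* K) (f g : MvPowerSeries (Fin n) k) :
    MvPowerSeries.map φ (hadamard f g) =
      hadamard (MvPowerSeries.map φ f) (MvPowerSeries.map φ g) := by
  ext m
  exact map_mul φ _ _

/-- A `k`-linear functional on `K` applied to the coefficients of a power series. -/
def mapDual [Algebra k K] (ψ : Module.Dual k K) :
    MvPowerSeries (Fin n) K →+ MvPowerSeries (Fin n) k where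
  toFun w := fun m => ψ (MvPowerSeries.coeff m w)
  map_zero' := by ext m; exact map_zero ψ
  map_add' a b := by ext m; exact map_add ψ _ _

theorem coeff_mapDual [Algebra k K] (ψ : Module.Dual k K) (w : MvPowerSeries (Fin n) K)
    (m : Fin n →₀ ℕ) :
    MvPowerSeries.coeff m (mapDual ψ w) = ψ (MvPowerSeries.coeff m w) := rfl

theorem mapDual_mul_map [Algebra k K] (ψ : Module.Dual k K) (w : MvPowerSeries (Fin n) K)
    (u : MvPowerSeries (Fin n) k) :
    mapDual ψ (w * MvPowerSeries.map (algebraMap k K) u) = mapDual ψ w * u := by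
  classical
  ext m
  rw [coeff_mapDual, MvPowerSeries.coeff_mul, MvPowerSeries.coeff_mul, map_sum]
  refine Finset.sum_congr rfl fun x _ => ?_
  rw [MvPowerSeries.coeff_map, mul_comm, ← Algebra.smul_def, map_smul, coeff_mapDual, smul_eq_mul,
    mul_comm]

theorem exists_coe_eq_mapDual [Algebra k K] (ψ : Module.Dual k K) (c : MvPolynomial (Fin n) K) :
    ∃ c' : MvPolynomial (Fin n) k, (c' : MvPowerSeries (Fin n) k) = mapDual ψ c := by
  classical
  refine ⟨∑ m ∈ c.support, MvPolynomial.monomial m (ψ (c.coeff m)), ?_⟩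
  ext m
  rw [MvPolynomial.coeff_coe, coeff_mapDual, MvPolynomial.coeff_coe, MvPolynomial.coeff_sum]
  simp only [MvPolynomial.coeff_monomial]
  rw [Finset.sum_ite_eq']
  split_ifs with h
  · rfl
  · rw [MvPolynomial.notMem_support_iff.mp h, map_zero]

/-- An annihilator over an extension field yields one over the base field. -/
theorem exists_annihilator_of_map [Algebra k K] {F : MvPowerSeries (Fin n) k}
    {B : (MvPolynomial (Fin n) K)[X]}
    (hB : B ∈ annihilators (MvPowerSeries.map (algebraMap k K) F)) :
    ∃ B' ∈ annihilators F, B'.natDegree ≤ B.natDegree := by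
  classical
  obtain ⟨hB0, hBF⟩ := hB
  obtain ⟨m, hm⟩ : ∃ m, B.leadingCoeff.coeff m ≠ 0 := by
    by_contra! h
    exact leadingCoeff_ne_zero.mpr hB0 (MvPolynomial.ext _ _ h)
  obtain ⟨ψ, hψ⟩ := Module.Projective.exists_dual_ne_zero k hm
  choose L hL using exists_coe_eq_mapDual (n := n) ψ
  refine ⟨∑ j ∈ Finset.range (B.natDegree + 1), C (L (B.coeff j)) * X ^ j, ⟨fun h => ?_, ?_⟩, ?_⟩
  · have h1 := congrArg (coeff · B.natDegree) h
    simp only [finsetSum_coeff, coeff_C_mul_X_pow, coeff_zero] at h1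
    rw [Finset.sum_ite_eq, if_pos (Finset.self_mem_range_succ _)] at h1
    have h2 := congrArg (MvPowerSeries.coeff m) (hL B.leadingCoeff)
    rw [leadingCoeff, h1, coeff_mapDual, MvPolynomial.coeff_coe, MvPolynomial.coeff_coe,
      MvPolynomial.coeff_zero] at h2
    exact hψ h2.symm
  · have h := congrArg (mapDual ψ) hBF
    rw [aeval_eq_sum_range, map_sum, map_zero] at h
    rw [← h, map_sum]
    refine Finset.sum_congr rfl fun j _ => ?_
    rw [map_mul, aeval_C, map_pow, aeval_X, Algebra.smul_def, ← map_pow, mapDual_mul_map,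
      algebraMap_eq_coe, algebraMap_eq_coe, hL]
  · exact natDegree_sum_le_of_forall_le _ _ fun j hj =>
      (natDegree_C_mul_X_pow_le _ _).trans (Nat.lt_succ_iff.mp (Finset.mem_range.mp hj))

theorem one_le_of_hasDegree {f : MvPowerSeries (Fin n) k} {d : ℕ} (hd : HasDegree f d) :
    1 ≤ d := by
  obtain ⟨A, hA, rfl⟩ := hd.1
  by_contra! h
  have hC := eq_C_of_natDegree_le_zero (Nat.lt_one_iff.mp h).le
  have h1 := hA.2
  rw [hC, aeval_C, algebraMap_eq_coe, MvPolynomial.coe_eq_zero_iff] at h1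
  rw [h1, C_0] at hC
  exact hA.1 hC

theorem two_le_dimBound {f : MvPowerSeries (Fin n) k} {d : ℕ} (hd : HasDegree f d) (h : ℕ)
    (hp : Fin n → ℕ) : 2 ≤ dimBound n d h hp := by
  have h1 := one_le_of_hasDegree hd
  have h2 : 1 ≤ min (∏ i, (hp i + 1)) ((n + h).choose n) :=
    le_min (Finset.prod_pos fun i _ => Nat.succ_pos _) (Nat.choose_pos (Nat.le_add_right n h))
  have := Nat.mul_le_mul (Nat.succ_le_succ h1) h2
  simpa [dimBound] using this

theorem exists_stable_subspace_map (p : ℕ) [Fact p.Prime] [CharP K p] [PerfectRing K p]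
    (φ : k →+* K) {f : MvPowerSeries (Fin n) k} {d h : ℕ} {hp : Fin n → ℕ} (hd : HasDegree f d)
    (hh : HasTotalHeight f h) (hhp : HasPartialHeight f hp) :
    ∃ V : Submodule K (MvPowerSeries (Fin n) K), MvPowerSeries.map φ f ∈ V ∧ Module.Finite K V ∧
      Module.finrank K V ≤ dimBound n d h hp ∧
      ∀ (r : Fin n → Fin p), ∀ w ∈ V, sect p (digit r) w ∈ V := by
  apply exists_stable_subspace
  · obtain ⟨A, hA, rfl⟩ := hd.1
    exact ⟨_, map_mem_annihilators φ hA, natDegree_map_le⟩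
  · obtain ⟨A, hA, rfl⟩ := hh.1
    exact ⟨_, map_mem_annihilators φ hA, totalDegT_map_le φ A⟩
  · intro i
    obtain ⟨A, hA, hAi⟩ := (hhp i).1
    exact ⟨_, map_mem_annihilators φ hA, (degT_map_le φ i A).trans_eq hAi⟩

end BaseChange

end AlgSeries

theorem theorem7 {k : Type*} [Field k] (p : ℕ) [Fact p.Prime] [CharP k p] (n : ℕ)
    (f g : MvPowerSeries (Fin n) k)
    (d d' h h' : ℕ) (hp hp' : Fin n → ℕ)
    (hf : IsAlgebraic (MvPolynomial (Fin n) k) f)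
    (hg : IsAlgebraic (MvPolynomial (Fin n) k) g)
    (hfd : AlgSeries.HasDegree f d) (hgd : AlgSeries.HasDegree g d')
    (hfh : AlgSeries.HasTotalHeight f h) (hgh : AlgSeries.HasTotalHeight g h')
    (hfp : AlgSeries.HasPartialHeight f hp) (hgp : AlgSeries.HasPartialHeight g hp') :
    IsAlgebraic (MvPolynomial (Fin n) k) (AlgSeries.hadamard f g) ∧
      ∃ D : ℕ, AlgSeries.HasDegree (AlgSeries.hadamard f g) D ∧
        D ≤ p ^ (AlgSeries.dimBound n d h hp * AlgSeries.dimBound n d' h' hp') - 1 := by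
  have : CharP (AlgebraicClosure k) p :=
    charP_of_injective_algebraMap (algebraMap k (AlgebraicClosure k)).injective p
  obtain ⟨V, hfV, hV, hVr, hVs⟩ := AlgSeries.exists_stable_subspace_map p
    (algebraMap k (AlgebraicClosure k)) hfd hfh hfp
  obtain ⟨V', hgV, hV', hVr', hVs'⟩ := AlgSeries.exists_stable_subspace_map p
    (algebraMap k (AlgebraicClosure k)) hgd hgh hgp
  obtain ⟨hW, hWr⟩ := AlgSeries.finrank_map₂_le
    (AlgSeries.hadamardBilin (AlgebraicClosure k) n) V V'
  have hN := Nat.mul_le_mul (AlgSeries.two_le_dimBound hfd h hp)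
    (AlgSeries.two_le_dimBound hgd h' hp')
  obtain ⟨B, hB, hBdeg⟩ := AlgSeries.exists_annihilator_of_stable p
    (fun r w hw => AlgSeries.sect_mem_map₂_hadamardBilin p (hVs r) (hVs' r) hw)
    (hWr.trans (Nat.mul_le_mul hVr hVr')) (by omega) (Submodule.apply_mem_map₂ _ hfV hgV)
  have hmap : AlgSeries.hadamardBilin (AlgebraicClosure k) n
      (MvPowerSeries.map (algebraMap k (AlgebraicClosure k)) f)
      (MvPowerSeries.map (algebraMap k (AlgebraicClosure k)) g) =
      MvPowerSeries.map (algebraMap k (AlgebraicClosure k)) (AlgSeries.hadamard f g) :=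
    (AlgSeries.map_hadamard _ f g).symm
  rw [hmap] at hB
  obtain ⟨B', hB', hdeg⟩ := AlgSeries.exists_annihilator_of_map hB
  refine ⟨⟨B', hB'.1, hB'.2⟩, ?_⟩
  have hne : (Polynomial.natDegree '' AlgSeries.annihilators (AlgSeries.hadamard f g)).Nonempty :=
    ⟨_, B', hB', rfl⟩
  refine ⟨_, ⟨Nat.sInf_mem hne, fun _ hx => Nat.sInf_le hx⟩, ?_⟩
  exact (Nat.sInf_le (Set.mem_image_of_mem _ hB')).trans (hdeg.trans hBdeg)
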